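/- Let $d\in\mathbb N$ and $T>0$, let $u_0\in H^1(\mathbb R^d)$ (complex valued), and let $q\in L^\infty(\mathbb R^d)$ be real valued with $q\ge 0$ almost everywhere. A solution of the Cauchy problem $$\partial_t u-\Delta u+qu=0,\qquad u(0,\cdot)=u_0 \qquad\qquad (P_{q,u_0})$$ means a function $u\in C([0,T];H^1(\mathbb R^d))\cap C^1((0,T);L^2(\mathbb R^d))$ with $u(0)=u_0$ that satisfies the equation in the sense of distributions on $\mathbb R^d$ for every $t\in(0,T)$; in particular every solution in $C^1([0,T];L^2)\cap C([0,T];H^1)$ is one. Let $\omega:(0,1]\to(0,\infty)$ satisfy $\omega(\varepsilon)\to0$ as $\varepsilon\to0$, let $\psi,\varphi$ be arbitrary (possibly different) Friedrichs mollifiers, i.e. non-negative functions in $C_c^\infty(\mathbb R^d)$ with integral $1$, and for $\varepsilon\in(0,1]$ let $$q_\varepsilon=q*\psi_\varepsilon,\quad u_{0,\varepsilon}=u_0*\varphi_\varepsilon,\qquad \psi_\varepsilon(x)=\omega(\varepsilon)^{-d}\psi\big(x/\omega(\varepsilon)\big),\quad \varphi_\varepsilon(x)=\omega(\varepsilon)^{-d}\varphi\big(x/\omega(\varepsilon)\big).$$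 Let $(u_\varepsilon)_{\varepsilon\in(0,1]}$ be a very weak solution of $(P_{q,u_0})$ with respect to these families: $(q_\varepsilon)$ is $L^\infty$-moderate, $(u_{0,\varepsilon})$ is $H^1$-moderate, for every $\varepsilon\in(0,1]$ the function $u_\varepsilon$ is a solution of $(P_{q_\varepsilon,u_{0,\varepsilon}})$, and $(u_\varepsilon)$ is $C([0,T];H^1)$-moderate. (A net $(f_\varepsilon)$ in a normed space $X$ is $X$-moderate if there are $N\in\mathbb N_0$ and $c>0$ with $\|f_\varepsilon\|_X\le c\,\omega(\varepsilon)^{-N}$ for all $\varepsilon\in(0,1]$.) Then $u_\varepsilon$ converges in $L^2(\mathbb R^d)$, uniformly in time, to the solution $u$ of $(P_{q,u_0})$: for every solution $u$ of $(P_{q,u_0})$, $$\sup_{t\in[0,T]}\|u_\varepsilon(t,\cdot)-u(t,\cdot)\|_{L^2(\mathbb R^d)}\longrightarrow0\qquad(\varepsilon\to0).$$ -/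

import Mathlib

open MeasureTheory Set Filter Topology
open scoped ENNReal SchwartzMap LineDeriv Laplacian

noncomputable section

namespace HeatPotential

/-- The space `ℝᵈ`. -/
abbrev Space (d : ℕ) : Type := EuclideanSpace ℝ (Fin d)

/-- `L²(ℝᵈ)`, complex valued. -/
abbrev L2 (d : ℕ) : Type := Lp ℂ 2 (volume : Measure (Space d))

/-- `L^∞(ℝᵈ)`, real valued. -/
abbrev LInfty (d : ℕ) : Type := Lp ℝ ∞ (volume : Measure (Space d))

/-- An `L²` function, viewed as a tempered distribution. -/
abbrev toDistribution {d : ℕ} (f : L2 d) : 𝓢'(Space d, ℂ) := (f : 𝓢'(Space d, ℂ))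

/-- The Sobolev space `H¹(ℝᵈ)`: the `L²` functions all of whose first-order distributional partial
derivatives belong to `L²`. An element is stored as the pair `(f, ∇f)`; the second component is
determined by the first. The norm is the one inherited from `L² × (L²)ᵈ`, that is
`‖f‖²_{H¹} = ‖f‖²_{L²} + ∑ i, ‖∂ᵢ f‖²_{L²}`. -/
def H1 (d : ℕ) : Submodule ℂ (WithLp 2 (L2 d × PiLp 2 (fun _ : Fin d => L2 d))) where
  carrier := {p | ∀ i : Fin d,
    ∂_{(EuclideanSpace.single i (1 : ℝ) : Space d)} (toDistribution p.fst)
      = toDistribution (p.snd i)}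
  zero_mem' := by
    intro i
    simp only [toDistribution, ← Lp.toTemperedDistributionCLM_apply, WithLp.zero_fst,
      WithLp.zero_snd, PiLp.zero_apply, map_zero, LineDeriv.lineDerivOp_zero]
  add_mem' := by
    intro a b ha hb i
    have ha' := ha i
    have hb' := hb i
    simp only [toDistribution, ← Lp.toTemperedDistributionCLM_apply, WithLp.add_fst,
      WithLp.add_snd, PiLp.add_apply, map_add, LineDeriv.lineDerivOp_add] at ha' hb' ⊢
    rw [ha', hb']
  smul_mem' := by
    intro c a ha i
    have ha' := ha i
    simp only [toDistribution, ← Lp.toTemperedDistributionCLM_apply, WithLp.smul_fst,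
      WithLp.smul_snd, PiLp.smul_apply, map_smul, LineDeriv.lineDerivOp_smul] at ha' ⊢
    rw [ha']

/-- The inclusion of `H¹(ℝᵈ)` in `L²(ℝᵈ)`. -/
def toL2 {d : ℕ} (f : H1 d) : L2 d :=
  (f : WithLp 2 (L2 d × PiLp 2 (fun _ : Fin d => L2 d))).fst

/-- Solutions on `[0,T] × ℝᵈ` of the Cauchy problem `∂ₜu - Δu + q u = 0`, `u(0) = v₀`, in the class
`C([0,T]; H¹) ∩ C¹((0,T); L²)`: at every time `t ∈ (0,T)` the equation holds in the sense of
distributions on `ℝᵈ`, where `∂ₜu(t)` is the derivative of the `L²`-valued map `u`, and hence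
`Δu(t)` is in `L²`. Values of `u` outside `[0,T]` play no role. -/
structure IsSolution {d : ℕ} (T : ℝ) (q : LInfty d) (v₀ : H1 d) (u : ℝ → H1 d) : Prop where
  continuousOn : ContinuousOn u (Icc 0 T)
  contDiffOn : ContDiffOn ℝ 1 (fun t => toL2 (u t)) (Ioo 0 T)
  equation : ∀ t ∈ Ioo 0 T,
    toDistribution (deriv (fun s => toL2 (u s)) t) - Δ (toDistribution (toL2 (u t)))
      + toDistribution (q • toL2 (u t)) = 0
  initial : u 0 = v₀

/-- Friedrichs mollifiers: smooth, compactly supported, non-negative, of integral one. -/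
structure IsFriedrichsMollifier {d : ℕ} (ψ : Space d → ℝ) : Prop where
  contDiff : ContDiff ℝ ((⊤ : ℕ∞) : WithTop ℕ∞) ψ
  hasCompactSupport : HasCompactSupport ψ
  nonneg : ∀ x, 0 ≤ ψ x
  integral_eq_one : ∫ x, ψ x = 1

/-- The rescaled function `x ↦ r⁻ᵈ ψ(x / r)`. -/
def rescale {d : ℕ} (ψ : Space d → ℝ) (r : ℝ) (x : Space d) : ℝ :=
  (r ^ d)⁻¹ * ψ (r⁻¹ • x)

/-- The convolution of `f` with `x ↦ r⁻ᵈ ψ(x / r)`. -/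
def mollify {d : ℕ} {F : Type*} [NormedAddCommGroup F] [NormedSpace ℝ F]
    (ψ : Space d → ℝ) (r : ℝ) (f : Space d → F) : Space d → F :=
  convolution (rescale ψ r) f (ContinuousLinearMap.lsmul ℝ ℝ) volume

/-- Scales of regularisation: positive functions `ω` on `(0,1]` with `ω(ε) → 0` as `ε → 0`. -/
structure IsScale (ω : ℝ → ℝ) : Prop where
  pos : ∀ ε ∈ Ioc (0 : ℝ) 1, 0 < ω ε
  tendsto : Tendsto ω (𝓝[>] 0) (𝓝 0)

/-- `(qε)_{ε ∈ (0,1]}` is a regularisation of `q ∈ L^∞` at scale `ω`: for some Friedrichs mollifier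
`ψ`, one has `qε = q * ψ_{ω(ε)}` for every `ε ∈ (0,1]`. -/
def IsRegularisationLInfty {d : ℕ} (ω : ℝ → ℝ) (q : LInfty d) (qε : ℝ → LInfty d) : Prop :=
  ∃ ψ : Space d → ℝ, IsFriedrichsMollifier ψ ∧
    ∀ ε ∈ Ioc (0 : ℝ) 1, ⇑(qε ε) =ᵐ[volume] mollify ψ (ω ε) ⇑q

/-- `(vε)_{ε ∈ (0,1]}` is a regularisation of `v ∈ H¹` at scale `ω`: for some Friedrichs mollifier
`ψ`, one has `vε = v * ψ_{ω(ε)}` for every `ε ∈ (0,1]`. -/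
def IsRegularisationH1 {d : ℕ} (ω : ℝ → ℝ) (v : H1 d) (vε : ℝ → H1 d) : Prop :=
  ∃ ψ : Space d → ℝ, IsFriedrichsMollifier ψ ∧
    ∀ ε ∈ Ioc (0 : ℝ) 1, ⇑(toL2 (vε ε)) =ᵐ[volume] mollify ψ (ω ε) ⇑(toL2 v)

/-- `X`-moderate nets. -/
def IsModerate {X : Type*} [NormedAddCommGroup X] (ω : ℝ → ℝ) (f : ℝ → X) : Prop :=
  ∃ N : ℕ, ∃ c > (0 : ℝ), ∀ ε ∈ Ioc (0 : ℝ) 1, ‖f ε‖ ≤ c * (ω ε ^ N)⁻¹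

/-- `C([0,T]; X)`-moderate nets, the norm of `C([0,T]; X)` being the supremum norm. -/
def IsCModerate {X : Type*} [NormedAddCommGroup X] (T : ℝ) (ω : ℝ → ℝ) (f : ℝ → ℝ → X) : Prop :=
  ∃ N : ℕ, ∃ c > (0 : ℝ), ∀ ε ∈ Ioc (0 : ℝ) 1, ∀ t ∈ Icc 0 T, ‖f ε t‖ ≤ c * (ω ε ^ N)⁻¹

/-- `(uε)` is a very weak solution of `∂ₜu - Δu + q u = 0`, `u(0) = u₀`, with respect to the
regularising families `(qε)` and `(u₀ε)`: these families are moderate regularisations of `q` and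
`u₀`, each `uε` solves the regularised Cauchy problem, and the net is `C([0,T]; H¹)`-moderate. -/
structure IsVeryWeakSolution {d : ℕ} (T : ℝ) (ω : ℝ → ℝ) (q : LInfty d) (u₀ : H1 d)
    (qε : ℝ → LInfty d) (u₀ε : ℝ → H1 d) (uε : ℝ → ℝ → H1 d) : Prop where
  regularisation_coeff : IsRegularisationLInfty ω q qε
  moderate_coeff : IsModerate ω qε
  regularisation_data : IsRegularisationH1 ω u₀ u₀ε
  moderate_data : IsModerate ω u₀ε
  solution : ∀ ε ∈ Ioc (0 : ℝ) 1, IsSolution T (qε ε) (u₀ε ε) (uε ε)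
  moderate : IsCModerate T ω uε

end HeatPotential

end

namespace HeatPotential

/-! ### Dissipativity and the energy inequality. -/

section Energy

open FourierTransform

variable {d : ℕ}

/-! The difference `z = uε - u` solves `∂ₜz - Δz + qε z = -(qε - q) u`. Since `Δ` is dissipative and
`qε ≥ 0`, pairing with `z` and a Gronwall argument bound `‖z(t)‖²` by `exp T` times the squared data
error plus the squared supremum over time of `‖(qε - q) u‖` (`IsSolution.norm_sub_sq_le`).

In general `qε` does not converge to `q` in `L^∞`, but `(qε - q) v → 0` in `L²` for each fixed `v`,
uniformly for `v` in a compact set. The orbit `{u(t)}` is such a set, being the continuous image of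
`[0,T]`. The uniformity comes from writing `(qε - q) v` as an average over small `y` of `(q(x - y) -
q(x)) v(x)`, which is jointly continuous in `(y, v)` with values in `L²` and vanishes at `y = 0`. -/

lemma toDistribution_add (f g : L2 d) :
    toDistribution (f + g) = toDistribution f + toDistribution g :=
  map_add (Lp.toTemperedDistributionCLM ℂ (volume : Measure (Space d)) 2) f g

lemma toDistribution_sub (f g : L2 d) :
    toDistribution (f - g) = toDistribution f - toDistribution g :=
  map_sub (Lp.toTemperedDistributionCLM ℂ (volume : Measure (Space d)) 2) f g

/-- In `L²`, the Laplacian acts on the Fourier side as multiplication by `-(2π)²‖ξ‖²`. -/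
lemma fourier_ae_eq_of_laplacian_eq {f g : L2 d}
    (h : Δ (toDistribution f) = toDistribution g) :
    ∀ᵐ ξ, (𝓕 g : L2 d) ξ = ((-(2 * Real.pi) ^ 2 * ‖ξ‖ ^ 2 : ℝ) : ℂ) * (𝓕 f : L2 d) ξ := by
  have hF : toDistribution (𝓕 g : L2 d) = ((-(2 * Real.pi) ^ 2 : ℝ) : ℂ) •
      TemperedDistribution.smulLeftCLM ℂ (fun x ↦ Complex.ofReal (‖x‖ ^ 2))
        (toDistribution (𝓕 f : L2 d)) := by
    simp only [toDistribution] at h ⊢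
    rw [← Lp.fourier_toTemperedDistribution_eq, ← Lp.fourier_toTemperedDistribution_eq, ← h,
      TemperedDistribution.laplacian_eq_fourierMultiplierCLM,
      TemperedDistribution.fourierMultiplierCLM_apply, ← Complex.coe_smul,
      ← FourierTransform.fourierInv_smul, FourierTransform.fourier_fourierInv_eq]
  -- The multiplier is unbounded, so the product is only known to be locally integrable; compactly
  -- supported test functions suffice.
  refine ae_eq_of_integral_contDiff_smul_eq
    ((Lp.memLp _).locallyIntegrable (by norm_num)) ?_ ?_
  · have hc : Continuous fun ξ : Space d => ((-(2 * Real.pi) ^ 2 * ‖ξ‖ ^ 2 : ℝ) : ℂ) := by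
      fun_prop
    rw [← locallyIntegrableOn_univ]
    exact (((Lp.memLp (𝓕 f : L2 d)).locallyIntegrable (by norm_num)).locallyIntegrableOn
      univ).continuousOn_mul hc.continuousOn isClosed_univ.isLocallyClosed
  · intro φ hφ hφc
    have hg₁ : HasCompactSupport (Complex.ofRealCLM ∘ φ) := hφc.comp_left rfl
    have hg₂ : ContDiff ℝ ((⊤ : ℕ∞) : WithTop ℕ∞) (Complex.ofRealCLM ∘ φ) := by fun_prop
    have hm : (fun x : Space d => Complex.ofReal (‖x‖ ^ 2)).HasTemperateGrowth := by fun_prop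
    have := DFunLike.congr_fun hF (hg₁.toSchwartzMap hg₂)
    simp only [toDistribution, _root_.smul_apply, TemperedDistribution.smulLeftCLM_apply_apply,
      Lp.toTemperedDistribution_apply, SchwartzMap.smulLeftCLM_apply_apply hm,
      ← integral_smul] at this
    convert! this using 2
    ext ξ
    simp
    ring

/-- The Laplacian is dissipative in `L²`. -/
lemma re_inner_nonpos_of_laplacian_eq {f g : L2 d}
    (h : Δ (toDistribution f) = toDistribution g) : (inner ℂ f g).re ≤ 0 := by
  -- By Plancherel the pairing becomes the integral of `-(2π)²‖ξ‖²|𝓕 f|²`.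
  rw [← Lp.inner_fourier_eq, L2.inner_def, ← RCLike.re_eq_complex_re,
    ← integral_re (L2.integrable_inner _ _)]
  refine integral_nonpos_of_ae ?_
  filter_upwards [fourier_ae_eq_of_laplacian_eq h] with ξ hξ
  rw [hξ, ← smul_eq_mul, inner_smul_right, inner_self_eq_norm_sq_to_K]
  simp only [RCLike.re_eq_complex_re, Complex.coe_algebraMap, ← Complex.ofReal_pow,
    ← Complex.ofReal_mul, Complex.ofReal_re, Pi.zero_apply]
  have : 0 ≤ (2 * Real.pi) ^ 2 * ‖ξ‖ ^ 2 * ‖(𝓕 f : L2 d) ξ‖ ^ 2 := by positivity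
  linarith

lemma re_inner_smul_nonneg {p : LInfty d} (hp : ∀ᵐ x, 0 ≤ p x) (f : L2 d) :
    0 ≤ (inner ℂ f (p • f : L2 d)).re := by
  rw [L2.inner_def, ← RCLike.re_eq_complex_re, ← integral_re (L2.integrable_inner _ _)]
  refine integral_nonneg_of_ae ?_
  filter_upwards [hp, Lp.coeFn_lpSMul (r := 2) p f] with x hx hx'
  rw [hx', Pi.smul_apply', ← Complex.coe_smul, inner_smul_right, inner_self_eq_norm_sq_to_K]
  simp only [RCLike.re_eq_complex_re, Complex.coe_algebraMap, ← Complex.ofReal_pow,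
    ← Complex.ofReal_mul, Complex.ofReal_re, Pi.zero_apply]
  positivity

/-- Since `2δ‖w‖ ≤ ‖w‖² + δ²`, the quantity `exp(-s)(‖w s‖² + δ²)` is nonincreasing. Working with
squares avoids differentiating the norm at zeros of `w`. -/
lemma norm_sq_le_of_re_inner_deriv_le {H : Type*} [NormedAddCommGroup H] [InnerProductSpace ℂ H]
    {T δ : ℝ} {w w' : ℝ → H} (hw : ContinuousOn w (Icc 0 T))
    (hw' : ∀ t ∈ Ioo 0 T, HasDerivAt w (w' t) t)
    (hle : ∀ t ∈ Ioo 0 T, (inner ℂ (w t) (w' t)).re ≤ δ * ‖w t‖) {t : ℝ} (ht : t ∈ Icc 0 T) :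
    ‖w t‖ ^ 2 ≤ Real.exp T * (‖w 0‖ ^ 2 + δ ^ 2) := by
  have hd : ∀ t ∈ Ioo 0 T, HasDerivAt (fun s => Real.exp (-s) * (‖w s‖ ^ 2 + δ ^ 2))
      (Real.exp (-t) * (2 * (inner ℂ (w t) (w' t)).re - ‖w t‖ ^ 2 - δ ^ 2)) t := by
    intro t ht
    have h1 := Complex.reCLM.hasFDerivAt.comp_hasDerivAt t ((hw' t ht).inner ℂ (hw' t ht))
    have h2 : HasDerivAt (fun s => ‖w s‖ ^ 2) (2 * (inner ℂ (w t) (w' t)).re) t := by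
      convert! h1 using 1
      · ext s
        simp [inner_self_eq_norm_sq_to_K, ← Complex.ofReal_pow]
      · have := inner_re_symm (𝕜 := ℂ) (w t) (w' t)
        simp only [RCLike.re_eq_complex_re] at this
        simp [this, two_mul]
    convert! (hasDerivAt_neg t).exp.mul (h2.add_const (δ ^ 2)) using 1
    ring
  have hanti : AntitoneOn (fun s => Real.exp (-s) * (‖w s‖ ^ 2 + δ ^ 2)) (Icc 0 T) := by
    refine antitoneOn_of_deriv_nonpos (convex_Icc 0 T) (by fun_prop) ?_ ?_
    · rw [interior_Icc]
      exact fun t ht => (hd t ht).differentiableAt.differentiableWithinAt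
    · rw [interior_Icc]
      intro t ht
      rw [(hd t ht).deriv]
      refine mul_nonpos_of_nonneg_of_nonpos (Real.exp_pos _).le ?_
      nlinarith [hle t ht, sq_nonneg (‖w t‖ - δ)]
  have h0 := hanti ⟨le_rfl, ht.1.trans ht.2⟩ ht ht.1
  simp only [neg_zero, Real.exp_zero, one_mul, Real.exp_neg] at h0
  rw [inv_mul_le_iff₀ (Real.exp_pos _)] at h0
  calc ‖w t‖ ^ 2 ≤ ‖w t‖ ^ 2 + δ ^ 2 := by nlinarith
    _ ≤ _ := h0
    _ ≤ _ := by gcongr; exact ht.2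

end Energy

end HeatPotential

namespace HeatPotential

/-! ### Averages in `L²` against a probability measure. -/

section Averages

variable {α β E : Type*} {mα : MeasurableSpace α} {mβ : MeasurableSpace β} [NormedAddCommGroup E]

lemma sq_lintegral_le_lintegral_sq {ν : Measure β} [IsProbabilityMeasure ν] {k : β → ℝ≥0∞}
    (hk : AEMeasurable k ν) : (∫⁻ y, k y ∂ν) ^ (2 : ℝ) ≤ ∫⁻ y, k y ^ (2 : ℝ) ∂ν := by
  have h := eLpNorm_le_eLpNorm_of_exponent_le (μ := ν) (f := k) (p := 1) (q := (2 : NNReal))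
    (by norm_num) hk.aestronglyMeasurable
  calc (∫⁻ y, k y ∂ν) ^ (2 : ℝ) = (eLpNorm k 1 ν) ^ (2 : ℝ) := by
        simp [eLpNorm_one_eq_lintegral_enorm]
    _ ≤ (eLpNorm k (2 : NNReal) ν) ^ (2 : ℝ) := by gcongr
    _ = _ := by
        have := eLpNorm_nnreal_pow_eq_lintegral (μ := ν) (f := k) (p := 2) (by norm_num)
        simpa using this

/-- Minkowski's inequality in `L²` for averages against a probability measure. -/
lemma eLpNorm_two_le_of_enorm_le_lintegral {μ : Measure α} [SFinite μ] {ν : Measure β}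
    [IsProbabilityMeasure ν] {k : α → β → E} {g : α → E} {C : ℝ≥0∞}
    (hk : AEStronglyMeasurable (Function.uncurry k) (μ.prod ν))
    (hg : ∀ᵐ x ∂μ, ‖g x‖ₑ ≤ ∫⁻ y, ‖k x y‖ₑ ∂ν)
    (hC : ∀ᵐ y ∂ν, eLpNorm (fun x => k x y) 2 μ ≤ C) : eLpNorm g 2 μ ≤ C := by
  have hpow : ∀ f : α → E, eLpNorm f 2 μ ^ (2 : ℝ) = ∫⁻ x, ‖f x‖ₑ ^ (2 : ℝ) ∂μ := fun f => by
    simpa using eLpNorm_nnreal_pow_eq_lintegral (μ := μ) (f := f) (p := 2) (by norm_num)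
  rw [← ENNReal.rpow_le_rpow_iff (z := 2) (by norm_num), hpow]
  calc ∫⁻ x, ‖g x‖ₑ ^ (2 : ℝ) ∂μ ≤ ∫⁻ x, ∫⁻ y, ‖k x y‖ₑ ^ (2 : ℝ) ∂ν ∂μ := by
        refine lintegral_mono_ae ?_
        filter_upwards [hg, hk.prodMk_left] with x hx hkx
        exact (ENNReal.rpow_le_rpow hx (by norm_num)).trans
          (sq_lintegral_le_lintegral_sq hkx.enorm)
    _ = ∫⁻ y, ∫⁻ x, ‖k x y‖ₑ ^ (2 : ℝ) ∂μ ∂ν :=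
        lintegral_lintegral_swap (hk.enorm.pow_const _)
    _ ≤ ∫⁻ y, C ^ (2 : ℝ) ∂ν := by
        refine lintegral_mono_ae ?_
        filter_upwards [hC] with y hy
        rw [← hpow]
        gcongr
    _ = C ^ (2 : ℝ) := by simp

end Averages

/-! ### Friedrichs mollifiers as probability densities. -/

section Mollification

variable {d : ℕ} {ψ : Space d → ℝ} {r : ℝ}

namespace IsFriedrichsMollifier

lemma continuous_rescale (hψ : IsFriedrichsMollifier ψ) : Continuous (rescale ψ r) := by
  have := hψ.contDiff.continuous
  unfold rescale
  fun_prop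

lemma rescale_nonneg (hψ : IsFriedrichsMollifier ψ) (hr : 0 < r) (x : Space d) :
    0 ≤ rescale ψ r x :=
  mul_nonneg (by positivity) (hψ.nonneg _)

lemma hasCompactSupport_rescale (hψ : IsFriedrichsMollifier ψ) (hr : 0 < r) :
    HasCompactSupport (rescale ψ r) :=
  (hψ.hasCompactSupport.comp_smul (inv_ne_zero hr.ne')).mul_left

lemma integral_rescale (hψ : IsFriedrichsMollifier ψ) (hr : 0 < r) :
    ∫ x, rescale ψ r x = 1 := by
  simp only [rescale]
  rw [integral_const_mul, Measure.integral_comp_inv_smul_of_nonneg _ _ hr.le,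
    hψ.integral_eq_one]
  have : r ^ d ≠ 0 := by positivity
  simp [this]

lemma eventually_rescale_support_subset (hψ : IsFriedrichsMollifier ψ) {U : Set (Space d)}
    (hU : U ∈ 𝓝 0) : ∀ᶠ r in 𝓝[>] (0 : ℝ), ∀ y, rescale ψ r y ≠ 0 → y ∈ U := by
  obtain ⟨δ, hδ, hδU⟩ := Metric.mem_nhds_iff.1 hU
  obtain ⟨R, hR⟩ := hψ.hasCompactSupport.isCompact.isBounded.subset_closedBall 0
  have h : ∀ᶠ r in 𝓝[>] (0 : ℝ), r * (|R| + 1) < δ := by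
    have : Tendsto (fun r : ℝ => r * (|R| + 1)) (𝓝[>] 0) (𝓝 0) := by
      have : Continuous (fun r : ℝ => r * (|R| + 1)) := by fun_prop
      simpa using (this.tendsto 0).mono_left nhdsWithin_le_nhds
    exact this.eventually_lt_const hδ
  filter_upwards [h, self_mem_nhdsWithin] with r hr (hr0 : 0 < r) y hy
  have hy' : r⁻¹ • y ∈ Metric.closedBall (0 : Space d) R :=
    hR (subset_tsupport _ (right_ne_zero_of_mul hy))
  rw [mem_closedBall_zero_iff, norm_smul, norm_inv, Real.norm_of_nonneg hr0.le,
    inv_mul_le_iff₀ hr0] at hy'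
  refine hδU (mem_ball_zero_iff.2 (hy'.trans_lt (lt_of_le_of_lt ?_ hr)))
  gcongr
  linarith [le_abs_self R]

lemma mollify_nonneg (hψ : IsFriedrichsMollifier ψ) (hr : 0 < r) {f : Space d → ℝ}
    (hf : ∀ᵐ x, 0 ≤ f x) (x : Space d) : 0 ≤ mollify ψ r f x := by
  rw [mollify, convolution_def]
  refine integral_nonneg_of_ae ?_
  have : ∀ᵐ y, 0 ≤ f (x - y) :=
    (Measure.measurePreserving_sub_left volume x).quasiMeasurePreserving.ae hf
  filter_upwards [this] with y hy
  simpa using mul_nonneg (hψ.rescale_nonneg hr y) hy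

lemma isProbabilityMeasure_withDensity (hψ : IsFriedrichsMollifier ψ) (hr : 0 < r) :
    IsProbabilityMeasure
      ((volume : Measure (Space d)).withDensity fun y => ENNReal.ofReal (rescale ψ r y)) := by
  constructor
  rw [withDensity_apply _ MeasurableSet.univ, Measure.restrict_univ,
    ← ofReal_integral_eq_lintegral_ofReal, hψ.integral_rescale hr, ENNReal.ofReal_one]
  · exact hψ.continuous_rescale.integrable_of_hasCompactSupport (hψ.hasCompactSupport_rescale hr)
  · exact ae_of_all _ (hψ.rescale_nonneg hr)

/-- As the kernel has mass one, `f x` can be moved inside the convolution integral. The bound is an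
average against a probability measure, as Minkowski's inequality requires. -/
lemma enorm_mollify_sub_le {F : Type*} [NormedAddCommGroup F] [NormedSpace ℝ F] [CompleteSpace F]
    (hψ : IsFriedrichsMollifier ψ) (hr : 0 < r) {f : Space d → F} (hf : LocallyIntegrable f)
    (x : Space d) :
    ‖mollify ψ r f x - f x‖ₑ ≤ ∫⁻ y, ‖f (x - y) - f x‖ₑ
      ∂(volume.withDensity fun y => ENNReal.ofReal (rescale ψ r y)) := by
  have hc := (hψ.continuous_rescale (r := r))
  have hi := hc.integrable_of_hasCompactSupport (μ := volume) (hψ.hasCompactSupport_rescale hr)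
  have h1 : Integrable fun y => rescale ψ r y • f (x - y) :=
    (hψ.hasCompactSupport_rescale hr).convolutionExists_left (ContinuousLinearMap.lsmul ℝ ℝ) hc hf x
  have h2 : mollify ψ r f x - f x = ∫ y, rescale ψ r y • (f (x - y) - f x) := by
    simp only [smul_sub]
    rw [integral_sub h1 (hi.smul_const _), integral_smul_const, hψ.integral_rescale hr, one_smul]
    rfl
  rw [h2]
  refine (enorm_integral_le_lintegral_enorm _).trans ?_
  rw [lintegral_withDensity_eq_lintegral_mul_non_measurable _
    (hc.measurable.ennreal_ofReal) (ae_of_all _ fun _ => ENNReal.ofReal_lt_top)]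
  refine lintegral_mono fun y => ?_
  simp only [Pi.mul_apply, enorm_smul, Real.enorm_of_nonneg (hψ.rescale_nonneg hr y)]
  rfl

end IsFriedrichsMollifier

end Mollification

end HeatPotential

namespace HeatPotential

/-! ### Convergence of the regularised data and potentials. -/

section Convergence

variable {d : ℕ}

/-- The translate `x ↦ v(x - y)` of an `L²` function. -/
noncomputable def translate (y : Space d) (v : L2 d) : L2 d :=
  Lp.compMeasurePreserving (fun x => x - y) (measurePreserving_sub_right volume y) v

lemma coeFn_translate (y : Space d) (v : L2 d) : translate y v =ᵐ[volume] fun x => v (x - y) :=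
  Lp.coeFn_compMeasurePreserving v _

lemma continuous_translate : Continuous fun p : Space d × L2 d => translate p.1 p.2 := by
  let g : C(Space d × L2 d, C(Space d, Space d)) :=
    (ContinuousMap.mk (fun a : (Space d × L2 d) × Space d => a.2 - a.1.1) (by fun_prop)).curry
  exact continuous_snd.compMeasurePreservingLp g.continuous
    (fun p => measurePreserving_sub_right volume p.1) (by norm_num)

lemma translate_zero (v : L2 d) : translate 0 v = v := by
  apply Lp.ext
  filter_upwards [coeFn_translate 0 v] with x hx
  simpa using hx

lemma lpSMul_sub (q : LInfty d) (v w : L2 d) :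
    (q • (v - w) : L2 d) = (q • v : L2 d) - (q • w : L2 d) := by
  rw [sub_eq_add_neg, Lp.add_smul, Lp.smul_neg, sub_eq_add_neg]

lemma continuous_lpSMul (q : LInfty d) : Continuous fun v : L2 d => (q • v : L2 d) := by
  refine LipschitzWith.continuous (K := ‖q‖₊) (LipschitzWith.of_dist_le_mul fun v w => ?_)
  rw [dist_eq_norm, dist_eq_norm, ← lpSMul_sub]
  exact Lp.norm_smul_le _ _

/-- Joint continuity and the compactness of `K` give one neighbourhood of `0` that serves every `v ∈
K`. -/
lemma eventually_norm_lt_of_continuous {e : Space d → L2 d → L2 d}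
    (he : Continuous fun p : Space d × L2 d => e p.1 p.2) (h0 : ∀ v, e 0 v = 0)
    {K : Set (L2 d)} (hK : IsCompact K) {η : ℝ} (hη : 0 < η) :
    ∀ᶠ y in 𝓝 (0 : Space d), ∀ v ∈ K, ‖e y v‖ < η := by
  refine hK.eventually_forall_of_forall_eventually fun v _ => ?_
  have : Tendsto (fun p : Space d × L2 d => ‖e p.1 p.2‖) (𝓝 (0, v)) (𝓝 0) := by
    simpa [h0] using (he.norm.tendsto (0, v))
  exact this.eventually_lt_const hη

/-- The commutator of translation and multiplication by `q`, applied to `v`: a representative of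
`x ↦ (q(x - y) - q(x)) v(x)`. -/
noncomputable def translationDefect (q : LInfty d) (y : Space d) (v : L2 d) : L2 d :=
  (translate y (q • v) - q • v) - translate y (q • (v - translate (-y) v))

/-- In general `y ↦ q(· - y)` is not continuous into `L^∞`. The definition therefore lets
translations act only on `L²` functions, where they are strongly continuous, and multiplies only by
the fixed `q`. -/
lemma continuous_translationDefect (q : LInfty d) :
    Continuous fun p : Space d × L2 d => translationDefect q p.1 p.2 := by
  have hq := continuous_lpSMul q
  have hs : Continuous fun p : Space d × L2 d => (q • p.2 : L2 d) := hq.comp continuous_snd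
  have h1 : Continuous fun p : Space d × L2 d => translate p.1 (q • p.2) :=
    continuous_translate.comp (continuous_fst.prodMk hs)
  have h2 : Continuous fun p : Space d × L2 d => translate (-p.1) p.2 :=
    continuous_translate.comp (continuous_fst.neg.prodMk continuous_snd)
  have h3 : Continuous fun p : Space d × L2 d => translate p.1 (q • (p.2 - translate (-p.1) p.2)) :=
    continuous_translate.comp (continuous_fst.prodMk (hq.comp (continuous_snd.sub h2)))
  exact (h1.sub hs).sub h3

lemma translationDefect_zero (q : LInfty d) (v : L2 d) : translationDefect q 0 v = 0 := by
  simp [translationDefect, translate_zero]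

lemma coeFn_translationDefect (q : LInfty d) (y : Space d) (v : L2 d) :
    translationDefect q y v =ᵐ[volume] fun x => (q (x - y) - q x) • v x := by
  have hy := (measurePreserving_sub_right (volume : Measure (Space d)) y).quasiMeasurePreserving
  have hqv := Lp.coeFn_lpSMul (r := 2) q v
  filter_upwards [Lp.coeFn_sub (translate y (q • v) - q • v)
      (translate y (q • (v - translate (-y) v))), Lp.coeFn_sub (translate y (q • v)) (q • v),
    coeFn_translate y (q • v), hqv, hy.ae hqv,
    coeFn_translate y (q • (v - translate (-y) v)),
    hy.ae (Lp.coeFn_lpSMul (r := 2) q (v - translate (-y) v)),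
    hy.ae (Lp.coeFn_sub v (translate (-y) v)), hy.ae (coeFn_translate (-y) v)]
    with x h1 h2 h3 h4 h5 h6 h7 h8 h9
  rw [translationDefect, h1, Pi.sub_apply, h2, Pi.sub_apply, h3, h4, h5, h6, h7, Pi.smul_apply',
    Pi.smul_apply', Pi.smul_apply', h8, Pi.sub_apply, h9]
  simp only [sub_neg_eq_add, sub_add_cancel, smul_sub, sub_smul]
  abel

variable {ω : ℝ → ℝ}

lemma IsScale.tendsto_nhdsGT (hω : IsScale ω) : Tendsto ω (𝓝[>] 0) (𝓝[>] 0) := by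
  refine tendsto_nhdsWithin_iff.2 ⟨hω.tendsto, ?_⟩
  filter_upwards [Ioc_mem_nhdsGT (zero_lt_one' ℝ)] with ε hε using hω.pos ε hε

lemma aestronglyMeasurable_sub_comp {F : Type*} [NormedAddCommGroup F]
    {f : Space d → F} (hf : AEStronglyMeasurable f volume) {ν : Measure (Space d)} [SFinite ν]
    (hν : ν ≪ volume) :
    AEStronglyMeasurable (fun p : Space d × Space d => f (p.1 - p.2) - f p.1)
      (volume.prod ν) :=
  ((hf.comp_quasiMeasurePreserving (quasiMeasurePreserving_sub volume volume)).mono_ac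
    (Measure.AbsolutelyContinuous.rfl.prod hν)).sub hf.comp_fst

namespace IsFriedrichsMollifier

variable {ψ : Space d → ℝ} {r : ℝ}

lemma ae_withDensity (hψ : IsFriedrichsMollifier ψ) {P : Space d → Prop}
    (h : ∀ y, rescale ψ r y ≠ 0 → P y) :
    ∀ᵐ y ∂(volume.withDensity fun y => ENNReal.ofReal (rescale ψ r y)), P y := by
  rw [ae_withDensity_iff hψ.continuous_rescale.measurable.ennreal_ofReal]
  exact ae_of_all _ fun y hy => h y fun h0 => hy (by simp [h0])

/-- Minkowski's inequality, with the defect at `y` as the averaged function; only `y` in the support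
of the kernel matter. -/
lemma norm_smul_sub_le (hψ : IsFriedrichsMollifier ψ) (hr : 0 < r) {q p : LInfty d}
    (hp : p =ᵐ[volume] mollify ψ r q) {v : L2 d} {η : ℝ} (hη : 0 ≤ η)
    (h : ∀ y, rescale ψ r y ≠ 0 → ‖translationDefect q y v‖ ≤ η) :
    ‖(p • v : L2 d) - (q • v : L2 d)‖ ≤ η := by
  have := hψ.isProbabilityMeasure_withDensity hr
  have hle := eLpNorm_two_le_of_enorm_le_lintegral (μ := volume)
    (ν := volume.withDensity fun y => ENNReal.ofReal (rescale ψ r y))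
    (k := fun x y => (q (x - y) - q x) • v x)
    (g := ((p • v : L2 d) - (q • v : L2 d) : L2 d)) (C := ENNReal.ofReal η)
    ((aestronglyMeasurable_sub_comp (Lp.aestronglyMeasurable q)
      (withDensity_absolutelyContinuous _ _)).smul (Lp.aestronglyMeasurable v).comp_fst) ?_ ?_
  · rwa [← Lp.enorm_def, ← ofReal_norm, ENNReal.ofReal_le_ofReal_iff hη] at hle
  · filter_upwards [hp, Lp.coeFn_sub (p • v : L2 d) (q • v : L2 d), Lp.coeFn_lpSMul (r := 2) p v,
      Lp.coeFn_lpSMul (r := 2) q v] with x h1 h2 h3 h4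
    rw [h2, Pi.sub_apply, h3, h4, Pi.smul_apply', Pi.smul_apply', ← sub_smul, h1]
    simp only [enorm_smul]
    rw [lintegral_mul_const' _ _ enorm_ne_top]
    gcongr
    exact hψ.enorm_mollify_sub_le hr ((Lp.memLp q).locallyIntegrable le_top) x
  · refine hψ.ae_withDensity fun y hy => ?_
    rw [← eLpNorm_congr_ae (coeFn_translationDefect q y v), ← Lp.enorm_def]
    rw [← ofReal_norm]
    exact ENNReal.ofReal_le_ofReal (h y hy)

lemma norm_sub_le (hψ : IsFriedrichsMollifier ψ) (hr : 0 < r) {v w : L2 d}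
    (hw : w =ᵐ[volume] mollify ψ r v) {η : ℝ} (hη : 0 ≤ η)
    (h : ∀ y, rescale ψ r y ≠ 0 → ‖translate y v - v‖ ≤ η) : ‖w - v‖ ≤ η := by
  have := hψ.isProbabilityMeasure_withDensity hr
  have hle := eLpNorm_two_le_of_enorm_le_lintegral (μ := volume)
    (ν := volume.withDensity fun y => ENNReal.ofReal (rescale ψ r y))
    (k := fun x y => v (x - y) - v x) (g := (w - v : L2 d)) (C := ENNReal.ofReal η)
    (aestronglyMeasurable_sub_comp (Lp.aestronglyMeasurable v)
      (withDensity_absolutelyContinuous _ _)) ?_ ?_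
  · rwa [← Lp.enorm_def, ← ofReal_norm, ENNReal.ofReal_le_ofReal_iff hη] at hle
  · filter_upwards [hw, Lp.coeFn_sub w v] with x h1 h2
    rw [h2, Pi.sub_apply, h1]
    exact hψ.enorm_mollify_sub_le hr ((Lp.memLp v).locallyIntegrable (by norm_num)) x
  · refine hψ.ae_withDensity fun y hy => ?_
    have he : (fun x => v (x - y) - v x) =ᵐ[volume] (translate y v - v : L2 d) := by
      filter_upwards [Lp.coeFn_sub (translate y v) v, coeFn_translate y v] with x h1 h2
      rw [h1, Pi.sub_apply, h2]
    rw [eLpNorm_congr_ae he, ← Lp.enorm_def]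
    rw [← ofReal_norm]
    exact ENNReal.ofReal_le_ofReal (h y hy)

end IsFriedrichsMollifier

lemma IsRegularisationLInfty.eventually_norm_smul_sub_le (hω : IsScale ω) {q : LInfty d}
    {qε : ℝ → LInfty d} (hq : IsRegularisationLInfty ω q qε) {K : Set (L2 d)} (hK : IsCompact K)
    {η : ℝ} (hη : 0 < η) :
    ∀ᶠ ε in 𝓝[>] (0 : ℝ), ∀ v ∈ K, ‖(qε ε • v : L2 d) - (q • v : L2 d)‖ ≤ η := by
  obtain ⟨ψ, hψ, h⟩ := hq
  filter_upwards [Ioc_mem_nhdsGT (zero_lt_one' ℝ), hω.tendsto_nhdsGT.eventually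
    (hψ.eventually_rescale_support_subset (eventually_norm_lt_of_continuous
      (continuous_translationDefect q) (translationDefect_zero q) hK hη))] with ε hε hU v hv
  exact hψ.norm_smul_sub_le (hω.pos ε hε) (h ε hε) hη.le fun y hy => (hU y hy v hv).le

lemma IsRegularisationH1.eventually_norm_sub_le (hω : IsScale ω) {v : H1 d}
    {vε : ℝ → H1 d} (hv : IsRegularisationH1 ω v vε) {η : ℝ} (hη : 0 < η) :
    ∀ᶠ ε in 𝓝[>] (0 : ℝ), ‖toL2 (vε ε) - toL2 v‖ ≤ η := by
  obtain ⟨ψ, hψ, h⟩ := hv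
  filter_upwards [Ioc_mem_nhdsGT (zero_lt_one' ℝ), hω.tendsto_nhdsGT.eventually
    (hψ.eventually_rescale_support_subset (eventually_norm_lt_of_continuous
      (e := fun y v => translate y v - v) (continuous_translate.sub continuous_snd)
      (fun v => by simp [translate_zero]) (isCompact_singleton (x := toL2 v)) hη))] with ε hε hU
  exact hψ.norm_sub_le (hω.pos ε hε) (h ε hε) hη.le
    fun y hy => (hU y hy _ rfl).le

lemma IsRegularisationLInfty.ae_nonneg (hω : IsScale ω) {q : LInfty d}
    {qε : ℝ → LInfty d} (hq : IsRegularisationLInfty ω q qε) (h0 : ∀ᵐ x, 0 ≤ q x) {ε : ℝ}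
    (hε : ε ∈ Ioc (0 : ℝ) 1) : ∀ᵐ x, 0 ≤ qε ε x := by
  obtain ⟨ψ, hψ, h⟩ := hq
  filter_upwards [h ε hε] with x hx
  rw [hx]
  exact hψ.mollify_nonneg (hω.pos ε hε) h0 x

end Convergence

/-! ### Stability of solutions in `L²`. -/

section Solutions

variable {d : ℕ} {T : ℝ} {q : LInfty d} {v₀ : H1 d} {u : ℝ → H1 d}

lemma continuous_toL2 : Continuous (toL2 : H1 d → L2 d) :=
  (WithLp.continuous_fst 2 _ _).comp continuous_subtype_val

namespace IsSolution

lemma continuousOn_toL2 (hu : IsSolution T q v₀ u) : ContinuousOn (fun t => toL2 (u t)) (Icc 0 T) :=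
  continuous_toL2.comp_continuousOn hu.continuousOn

lemma hasDerivAt (hu : IsSolution T q v₀ u) {t : ℝ} (ht : t ∈ Ioo 0 T) :
    HasDerivAt (fun s => toL2 (u s)) (deriv (fun s => toL2 (u s)) t) t :=
  ((hu.contDiffOn.differentiableOn one_ne_zero).differentiableAt
    (isOpen_Ioo.mem_nhds ht)).hasDerivAt

lemma laplacian_eq (hu : IsSolution T q v₀ u) {t : ℝ} (ht : t ∈ Ioo 0 T) :
    Δ (toDistribution (toL2 (u t)))
      = toDistribution (deriv (fun s => toL2 (u s)) t + q • toL2 (u t)) := by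
  have h := hu.equation t ht
  rw [toDistribution_add]
  rw [sub_add_eq_add_sub, sub_eq_zero] at h
  exact h.symm

/-- Stability of the Cauchy problem in `L²` under perturbation of the potential and the data. -/
lemma norm_sub_sq_le {p : LInfty d} {w₀ : H1 d} {w : ℝ → H1 d} (hw : IsSolution T p w₀ w)
    (hu : IsSolution T q v₀ u) (hp : ∀ᵐ x, 0 ≤ p x) {δ : ℝ}
    (hδ : ∀ t ∈ Ioo 0 T, ‖(p • toL2 (u t) : L2 d) - (q • toL2 (u t) : L2 d)‖ ≤ δ) {t : ℝ}
    (ht : t ∈ Icc 0 T) :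
    ‖toL2 (w t) - toL2 (u t)‖ ^ 2 ≤ Real.exp T * (‖toL2 w₀ - toL2 v₀‖ ^ 2 + δ ^ 2) := by
  rw [← hw.initial, ← hu.initial]
  refine norm_sq_le_of_re_inner_deriv_le (w := fun s => toL2 (w s) - toL2 (u s))
    (hw.continuousOn_toL2.sub hu.continuousOn_toL2)
    (fun s hs => (hw.hasDerivAt hs).sub (hu.hasDerivAt hs)) (fun s hs => ?_) ht
  set a := deriv (fun s => toL2 (w s)) s
  set b := deriv (fun s => toL2 (u s)) s
  set z := toL2 (w s) - toL2 (u s) with hz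
  set F := (p • toL2 (u s) : L2 d) - (q • toL2 (u s) : L2 d)
  -- The splitting `p w - q u = p z + (p - q) u` puts the sign condition on `p` and leaves an error
  -- depending only on `u`, which stays fixed when `p` and `w` vary.
  have hΔ : Δ (toDistribution z) = toDistribution ((a - b) + p • z + F) := by
    have : Δ (toDistribution z)
        = Δ (toDistribution (toL2 (w s))) - Δ (toDistribution (toL2 (u s))) := by
      rw [hz, toDistribution_sub, ← TemperedDistribution.laplacianCLM_apply, map_sub,
        TemperedDistribution.laplacianCLM_apply, TemperedDistribution.laplacianCLM_apply]
    rw [this, hw.laplacian_eq hs, hu.laplacian_eq hs, ← toDistribution_sub, hz, lpSMul_sub]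
    congr 1
    simp only [a, b, F]
    abel
  have h1 := re_inner_nonpos_of_laplacian_eq hΔ
  have h2 := re_inner_smul_nonneg hp z
  have h3 : -(‖z‖ * δ) ≤ (inner ℂ z F).re := by
    have h4 := (abs_le.1 ((Complex.abs_re_le_norm _).trans (norm_inner_le_norm (𝕜 := ℂ) z F))).1
    have h5 := mul_le_mul_of_nonneg_left (hδ s hs) (norm_nonneg z)
    linarith
  rw [inner_add_right, inner_add_right, Complex.add_re, Complex.add_re] at h1
  linarith

end IsSolution

end Solutions

end HeatPotential

theorem mainTheorem4 {d : ℕ} (T : ℝ) (hT : 0 < T)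
    (u₀ : HeatPotential.H1 d) (q : HeatPotential.LInfty d) (hq : ∀ᵐ x, 0 ≤ q x)
    (ω : ℝ → ℝ) (hω : HeatPotential.IsScale ω)
    (qε : ℝ → HeatPotential.LInfty d) (u₀ε : ℝ → HeatPotential.H1 d)
    (uε : ℝ → ℝ → HeatPotential.H1 d)
    (huε : HeatPotential.IsVeryWeakSolution T ω q u₀ qε u₀ε uε)
    (u : ℝ → HeatPotential.H1 d) (hu : HeatPotential.IsSolution T q u₀ u) :
    TendstoUniformlyOn (fun ε t => HeatPotential.toL2 (uε ε t)) (fun t => HeatPotential.toL2 (u t)) (𝓝[>] 0) (Icc 0 T) := by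
  rw [Metric.tendstoUniformlyOn_iff]
  intro η hη
  -- One `δ` bounds both the data error and the potential error, hence the two squares.
  obtain ⟨δ, hδ, hδη⟩ : ∃ δ > 0, Real.exp T * (δ ^ 2 + δ ^ 2) < η ^ 2 := by
    have h : Tendsto (fun δ : ℝ => Real.exp T * (δ ^ 2 + δ ^ 2)) (𝓝[>] 0) (𝓝 0) := by
      have hc : Continuous fun δ : ℝ => Real.exp T * (δ ^ 2 + δ ^ 2) := by fun_prop
      simpa using (hc.tendsto 0).mono_left nhdsWithin_le_nhds
    obtain ⟨δ, h1, h2⟩ := ((h.eventually_lt_const (sq_pos_of_pos hη)).and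
      self_mem_nhdsWithin).exists
    exact ⟨δ, h2, h1⟩
  have hK : IsCompact ((fun t => HeatPotential.toL2 (u t)) '' Icc 0 T) :=
    isCompact_Icc.image_of_continuousOn hu.continuousOn_toL2
  filter_upwards [Ioc_mem_nhdsGT (zero_lt_one' ℝ),
    huε.regularisation_data.eventually_norm_sub_le hω hδ,
    huε.regularisation_coeff.eventually_norm_smul_sub_le hω hK hδ] with ε hε hdata hcoeff t ht
  have h := (huε.solution ε hε).norm_sub_sq_le hu
    (huε.regularisation_coeff.ae_nonneg hω hq hε)
    (fun s hs => hcoeff _ (mem_image_of_mem _ (Ioo_subset_Icc_self hs))) ht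
  rw [dist_comm, dist_eq_norm]
  refine lt_of_pow_lt_pow_left₀ 2 hη.le (h.trans_lt (lt_of_le_of_lt ?_ hδη))
  gcongr
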